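/- Let $N\ge 1$, let $\sigma_1,\dots,\sigma_N>0$, and let $B=[b_{ij}]\in\mathbb{R}^{N\times N}$ be the adjacency matrix of a strongly connected undirected signed graph: $B$ is symmetric, $b_{ii}=0$, and $(i,j)$ is an edge iff $b_{ij}\ne 0$, the weight being positive or negative. Put $\Sigma=\mathrm{diag}(\sigma_1,\dots,\sigma_N)$ and $E=B-\Sigma$, and consider the opinion dynamics of the stubborn extremists scenario $$\dot x=(I-\mathrm{diag}(x)^2)\,E\,x,\qquad t\ge 0 .$$ A square matrix $M$ is called eventually positive if there is $k_0\geq 1$ such that all entries of $M^k$ are positive for every $k\ge k_0$; $\rho(M)$ denotes its spectral radius. Suppose that one of the following holds. - (Assumption 1) $B$ is eventually positive and $\sigma_1=\dots=\sigma_N\ge\rho(B)$. In this case put $M=B$, and call the case critical if $\sigma_i=\rho(B)$ for all $i$. - (Assumption 2) $B$ is not eventually positive, and for some $d\in\mathbb{R}$ the matrix $C=B+dI-\Sigma$ (so that $E=C-dI$) is eventually positive and $d\ge\rho(C)$. In this case put $M=C$, and call the case critical if $d=\rho(C)$. Then $M$ has an entrywise positive right eigenvector for the eigenvalue $\rho(M)$.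 Let $v_r$ be any such eigenvector, and $\mathcal J=\{j : (v_r)_j=\|v_r\|_\infty\}$. For each initial state $x(0)$ considered below there is a solution on $[0,\infty)$, and every solution from it behaves as stated. 1. If $x(0)\in(-1,1)^N$, then $\lim_{t\to\infty}x(t)=\alpha v_r$ for some $\alpha\in\left(-\frac1{\|v_r\|_\infty},\frac1{\|v_r\|_\infty}\right)$. 2. Let $\mathcal I\subset\{1,\dots,N\}$ be non-empty with non-empty complement, and let $y_1^*\in\{-1,1\}^{\mathcal I}$. Let $\bar E_{22}$ be the submatrix of $E$ with rows and columns outside $\mathcal I$, and $\bar E_{21}$ the submatrix with rows outside $\mathcal I$ and columns in $\mathcal I$. Suppose that $\bar E_{22}$ is nonsingular and that all entries of $y_2^*=-\bar E_{22}^{-1}\bar E_{21}y_1^*$ lie in $(-1,1)$. Then the point $x^*$ with entries $y_1^*$ on $\mathcal I$ and $y_2^*$ outside $\mathcal I$ is an equilibrium, and $\lim_{t\to\infty}x(t)=x^*$ whenever $x_i(0)=(y_1^*)_i$ for $i\in\mathcal I$ and $x_i(0)\in(-1,1)$ for $i\notin\mathcal I$. 3. In the critical case, if $v_r\ne\mathbf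 1$, then every solution with $x_i(0)=1$ for $i\in\mathcal J$ and $x_i(0)\in(-1,1)$ for $i\notin\mathcal J$ converges to $\frac1{\|v_r\|_\infty}v_r$. 4. In the critical case, if $v_r\ne\mathbf 1$, then every solution with $x_i(0)=-1$ for $i\in\mathcal J$ and $x_i(0)\in(-1,1)$ for $i\notin\mathcal J$ converges to $-\frac1{\|v_r\|_\infty}v_r$. -/

import Mathlib

open Set Filter Topology

/-- A real square matrix is eventually positive if all its sufficiently high powers are entrywise
positive. -/
def EventuallyPositive {N : ℕ} (M : Matrix (Fin N) (Fin N) ℝ) : Prop :=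
  ∃ k₀ : ℕ, 0 < k₀ ∧ ∀ k : ℕ, k₀ ≤ k → ∀ i j, 0 < (M ^ k) i j

/-- The spectral radius of a real square matrix: the largest modulus of its complex eigenvalues. -/
noncomputable def specRad {N : ℕ} (M : Matrix (Fin N) (Fin N) ℝ) : ℝ :=
  (spectralRadius ℂ (M.map (fun r : ℝ => (r : ℂ)))).toReal

/-- `v` is an entrywise positive right eigenvector of `M` for the eigenvalue `ρ(M)`. -/
def IsPosRightEigenvector {N : ℕ} (M : Matrix (Fin N) (Fin N) ℝ) (v : Fin N → ℝ) : Prop :=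
  (∀ i, 0 < v i) ∧ M.mulVec v = specRad M • v

/-- Strong connectivity of the signed digraph with adjacency matrix `B`, in which `(i, j)` is an
edge (positive or negative) when `B i j ≠ 0`. -/
def StronglyConnected {N : ℕ} (B : Matrix (Fin N) (Fin N) ℝ) : Prop :=
  ∀ i j, i ≠ j → Relation.TransGen (fun k l => B k l ≠ 0) i j

/-- The system matrix `E = B - Σ`. -/
def systemMatrix {N : ℕ} (B : Matrix (Fin N) (Fin N) ℝ) (σ : Fin N → ℝ) :
    Matrix (Fin N) (Fin N) ℝ :=
  B - Matrix.diagonal σ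

/-- The matrix `C = B + D` with `D = d I - Σ`, so that `E = C - d I`. -/
def shiftedMatrix {N : ℕ} (B : Matrix (Fin N) (Fin N) ℝ) (σ : Fin N → ℝ) (d : ℝ) :
    Matrix (Fin N) (Fin N) ℝ :=
  B + (d • (1 : Matrix (Fin N) (Fin N) ℝ) - Matrix.diagonal σ)

/-- First assumption: `B` is eventually positive and all forgetting factors are equal and at least
`ρ(B)`. -/
def Assumption1 {N : ℕ} (B : Matrix (Fin N) (Fin N) ℝ) (σ : Fin N → ℝ) : Prop :=
  EventuallyPositive B ∧ (∀ i j, σ i = σ j) ∧ ∀ i, specRad B ≤ σ i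

/-- Second assumption, for the shift `d`: `B` is not eventually positive, but `C = B + d I - Σ` is,
and `d ≥ ρ(C)`. -/
def Assumption2 {N : ℕ} (B : Matrix (Fin N) (Fin N) ℝ) (σ : Fin N → ℝ) (d : ℝ) : Prop :=
  ¬ EventuallyPositive B ∧ EventuallyPositive (shiftedMatrix B σ d) ∧
    specRad (shiftedMatrix B σ d) ≤ d

/-- The right-hand side `A(x) E x` of the opinion dynamics, `A(x) = diag (a₁(x₁), …, a_N(x_N))`. -/
def opinionField {N : ℕ} (a : Fin N → ℝ → ℝ) (E : Matrix (Fin N) (Fin N) ℝ) (x : Fin N → ℝ) :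
    Fin N → ℝ :=
  (Matrix.diagonal (fun i => a i (x i))).mulVec (E.mulVec x)

/-- The susceptibility functions of the stubborn extremists scenario: `A(x) = I - diag(x)²`. -/
def stubbornExtremists {N : ℕ} : Fin N → ℝ → ℝ := fun _ s => 1 - s ^ 2

/-- `x` solves `ẋ = A(x) E x` on the time interval `[0, ∞)`. -/
def IsSolution {N : ℕ} (a : Fin N → ℝ → ℝ) (E : Matrix (Fin N) (Fin N) ℝ)
    (x : ℝ → Fin N → ℝ) : Prop :=
  ∀ t : ℝ, 0 ≤ t → HasDerivWithinAt x (opinionField a E (x t)) (Ici 0) t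

/-- The dynamics started at `x₀` has a solution on `[0, ∞)`, and every such solution tends to
`xs`. -/
def SolutionsTendTo {N : ℕ} (a : Fin N → ℝ → ℝ) (E : Matrix (Fin N) (Fin N) ℝ)
    (x₀ xs : Fin N → ℝ) : Prop :=
  (∃ x, IsSolution a E x ∧ x 0 = x₀) ∧
    ∀ x, IsSolution a E x → x 0 = x₀ → Tendsto x atTop (𝓝 xs)

/-- The block `E₂₂` of `E`: rows and columns of the free agents, those outside `I`. -/
def blockFree {N : ℕ} (E : Matrix (Fin N) (Fin N) ℝ) (I : Finset (Fin N)) :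
    Matrix {i // i ∉ I} {i // i ∉ I} ℝ :=
  E.submatrix Subtype.val Subtype.val

/-- The block `E₂₁` of `E`: rows of the free agents, columns of the frozen agents. -/
def blockFreeFrozen {N : ℕ} (E : Matrix (Fin N) (Fin N) ℝ) (I : Finset (Fin N)) :
    Matrix {i // i ∉ I} {i // i ∈ I} ℝ :=
  E.submatrix Subtype.val Subtype.val

/-- The free part `y₂* = -E₂₂⁻¹ E₂₁ y₁` of the reduced equilibrium when the agents in `I` are frozen
at `y₁`. -/
noncomputable def freeEquilibrium {N : ℕ} (E : Matrix (Fin N) (Fin N) ℝ) (I : Finset (Fin N))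
    (y₁ : {i // i ∈ I} → ℝ) : {i // i ∉ I} → ℝ :=
  (-((blockFree E I)⁻¹ * blockFreeFrozen E I)).mulVec y₁

/-- The reduced equilibrium `x*`, with entries `y₁` on `I` and `y₂*` outside `I`. -/
noncomputable def reducedEquilibrium {N : ℕ} (E : Matrix (Fin N) (Fin N) ℝ) (I : Finset (Fin N))
    (y₁ : {i // i ∈ I} → ℝ) : Fin N → ℝ :=
  fun i => if h : i ∈ I then y₁ ⟨i, h⟩ else freeEquilibrium E I y₁ ⟨i, h⟩

/-- The convergence statements for the stubborn extremists scenario with system matrix `E`, where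
`M` is the eventually positive matrix whose positive right eigenvector `v` describes the limits, and
`critical` is the condition under which the last two statements apply.
`‖v‖` is the infinity norm of `v : Fin N → ℝ`. -/
def StubbornExtremistsConvergence {N : ℕ} (M E : Matrix (Fin N) (Fin N) ℝ) (critical : Prop) :
    Prop :=
  (∃ v, IsPosRightEigenvector M v) ∧
  -- starting in the open cube
  (∀ v, IsPosRightEigenvector M v →
    ∀ x₀ : Fin N → ℝ, (∀ i, x₀ i ∈ Ioo (-1 : ℝ) 1) →
      ∃ α ∈ Ioo (-(1 / ‖v‖)) (1 / ‖v‖), SolutionsTendTo stubbornExtremists E x₀ (α • v)) ∧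
  -- some, but not all, agents frozen at `±1`
  (∀ I : Finset (Fin N), I.Nonempty → Iᶜ.Nonempty →
    ∀ y₁ : {i // i ∈ I} → ℝ, (∀ i, |y₁ i| = 1) →
      IsUnit (blockFree E I).det →
      (∀ i, freeEquilibrium E I y₁ i ∈ Ioo (-1 : ℝ) 1) →
      opinionField stubbornExtremists E (reducedEquilibrium E I y₁) = 0 ∧
      ∀ x₀ : Fin N → ℝ, (∀ i : {i // i ∈ I}, x₀ i = y₁ i) → (∀ i, i ∉ I → x₀ i ∈ Ioo (-1 : ℝ) 1) →
        SolutionsTendTo stubbornExtremists E x₀ (reducedEquilibrium E I y₁)) ∧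
  -- critical case, the agents with maximal entry of `v` frozen at `1`
  (critical → ∀ v, IsPosRightEigenvector M v → v ≠ 1 →
    ∀ x₀ : Fin N → ℝ, (∀ i, v i = ‖v‖ → x₀ i = 1) → (∀ i, v i ≠ ‖v‖ → x₀ i ∈ Ioo (-1 : ℝ) 1) →
      SolutionsTendTo stubbornExtremists E x₀ ((1 / ‖v‖) • v)) ∧
  -- critical case, the agents with maximal entry of `v` frozen at `-1`
  (critical → ∀ v, IsPosRightEigenvector M v → v ≠ 1 →
    ∀ x₀ : Fin N → ℝ, (∀ i, v i = ‖v‖ → x₀ i = -1) → (∀ i, v i ≠ ‖v‖ → x₀ i ∈ Ioo (-1 : ℝ) 1) →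
      SolutionsTendTo stubbornExtremists E x₀ (-((1 / ‖v‖) • v)))

/-! ### Spectral radius and Perron–Frobenius for symmetric matrices -/

section SpectralRadius

open scoped Matrix

variable {N : ℕ} {M : Matrix (Fin N) (Fin N) ℝ}

/-! Under either assumption `E = M - c I` with `M` symmetric, eventually positive and `c ≥ ρ(M)`. So
`E` is negative semidefinite, with kernel `0` if `c > ρ(M)` and `ℝ v` if `c = ρ(M)`
(`EventuallyPositive.eq_smul_of_mulVec_eq`). Agents at `±1` are frozen.

Let `p` agree with the frozen agents, have its free entries in `(-1, 1)`, and satisfy `(E p)_i = 0`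
at every free `i`. A sum of logarithmic barriers is nonnegative and has derivative `Q = (x - p)ᵀ E
(x - p) ≤ 0` along solutions, while `Q' = 2 ∑ (1 - x_i²) (E (x - p))_i² ≥ 0`. A nonnegative
nonincreasing `-Q` with bounded integral tends to `0`, so every cluster point `q` has `q - p ∈ ker
E`. If no nonzero kernel vector vanishes on the frozen agents, then `q = p` and the solution
converges by compactness (`solutionsTendTo_of_definite`).

This leaves the critical case in the open cube, where the cluster points lie on the line `ℝ v`. The
barrier keeps the solution away from the boundary, and the conserved quantity `∑ v_i artanh x_i`,
strictly monotone on that line, singles out one point. -/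

lemma mem_spectrum_ofReal_iff (μ : ℝ) :
    (μ : ℂ) ∈ spectrum ℂ (M.map (fun r : ℝ => (r : ℂ))) ↔ ∃ u ≠ 0, M *ᵥ u = μ • u := by
  have hmap : algebraMap ℂ (Matrix (Fin N) (Fin N) ℂ) μ - M.map (fun r : ℝ => (r : ℂ)) =
      (algebraMap ℝ (Matrix (Fin N) (Fin N) ℝ) μ - M).map Complex.ofRealHom := by
    ext i j
    by_cases h : i = j <;> simp [Matrix.algebraMap_matrix_apply, h]
  rw [spectrum.mem_iff, hmap, Matrix.isUnit_iff_isUnit_det, ← RingHom.mapMatrix_apply,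
    ← RingHom.map_det, isUnit_iff_ne_zero, not_not, map_eq_zero, ← Matrix.exists_mulVec_eq_zero_iff]
  refine exists_congr fun u => and_congr_right fun _ => ?_
  rw [Matrix.sub_mulVec, Algebra.algebraMap_eq_smul_one, Matrix.smul_mulVec, Matrix.one_mulVec,
    sub_eq_zero, eq_comm]

/-- `specRad` is defined through `toReal`, which sends `⊤` to `0`; finiteness is what makes it
comparable with eigenvalues. -/
lemma spectralRadius_lt_top (A : Matrix (Fin N) (Fin N) ℂ) : spectralRadius ℂ A < ⊤ := by
  let := Matrix.linftyOpNormedRing (n := Fin N) (α := ℂ)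
  let := Matrix.linftyOpNormedAlgebra (n := Fin N) (α := ℂ) (R := ℂ)
  rcases subsingleton_or_nontrivial (Matrix (Fin N) (Fin N) ℂ) with h | h
  · simp [spectralRadius, spectrum.of_subsingleton]
  · rcases (spectrum ℂ A).eq_empty_or_nonempty with h0 | h0
    · simp [spectralRadius, h0]
    · obtain ⟨k, -, hk⟩ := spectrum.exists_nnnorm_eq_spectralRadius_of_nonempty h0
      simp [← hk]

lemma specRad_nonneg : 0 ≤ specRad M := ENNReal.toReal_nonneg

lemma abs_le_specRad {u : Fin N → ℝ} {μ : ℝ} (hu : u ≠ 0) (h : M *ᵥ u = μ • u) :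
    |μ| ≤ specRad M := by
  have hmem := (mem_spectrum_ofReal_iff μ).2 ⟨u, hu, h⟩
  have hle : ((‖(μ : ℂ)‖₊ : NNReal) : ENNReal) ≤
      spectralRadius ℂ (M.map (fun r : ℝ => (r : ℂ))) :=
    le_iSup₂ (α := ENNReal) (μ : ℂ) hmem
  have := ENNReal.toReal_mono (spectralRadius_lt_top _).ne hle
  simpa [specRad] using this

/-- The complexification is Hermitian, so a spectral value of maximal modulus is real and has a real
eigenvector. -/
lemma exists_abs_eq_specRad (hN : 0 < N) (hM : M.IsSymm) :
    ∃ u ≠ 0, ∃ μ : ℝ, M *ᵥ u = μ • u ∧ |μ| = specRad M := by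
  let := Matrix.linftyOpNormedRing (n := Fin N) (α := ℂ)
  let := Matrix.linftyOpNormedAlgebra (n := Fin N) (α := ℂ) (R := ℂ)
  have : Nonempty (Fin N) := ⟨⟨0, hN⟩⟩
  have hH : (M.map (fun r : ℝ => (r : ℂ))).IsHermitian := by
    ext i j
    simp [Matrix.conjTranspose_apply, hM.apply i j]
  obtain ⟨k, hk, hk'⟩ := spectrum.exists_nnnorm_eq_spectralRadius (M.map (fun r : ℝ => (r : ℂ)))
  have hk2 := hk
  rw [hH.spectrum_eq_image_range] at hk2
  obtain ⟨μ, -, rfl⟩ := hk2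
  obtain ⟨u, hu, h⟩ := (mem_spectrum_ofReal_iff μ).1 hk
  refine ⟨u, hu, μ, h, ?_⟩
  rw [specRad, ← hk']
  simp

/-- A symmetric matrix is bounded above by its spectral radius in the Loewner order. -/
lemma posSemidef_smul_one_sub (hM : M.IsSymm) {c : ℝ} (hc : specRad M ≤ c) :
    (c • (1 : Matrix (Fin N) (Fin N) ℝ) - M).PosSemidef := by
  have hH : (c • (1 : Matrix (Fin N) (Fin N) ℝ) - M).IsHermitian := by
    rw [Matrix.IsHermitian, Matrix.conjTranspose_eq_transpose_of_trivial]
    simp [hM.eq]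
  refine hH.posSemidef_iff_eigenvalues_nonneg.2 fun i => ?_
  have hv := hH.mulVec_eigenvectorBasis i
  have hne : (hH.eigenvectorBasis i : EuclideanSpace ℝ (Fin N)).ofLp ≠ 0 := fun h =>
    hH.eigenvectorBasis.orthonormal.ne_zero i (by ext j; exact congrFun h j)
  -- An eigenvalue `l` of `c I - M` gives the eigenvalue `c - l` of `M`, whence `c - l ≤ ρ(M) ≤ c`.
  rw [Matrix.sub_mulVec, Matrix.smul_mulVec, Matrix.one_mulVec, sub_eq_iff_eq_add,
    ← sub_eq_iff_eq_add', ← sub_smul] at hv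
  have := (le_abs_self _).trans (abs_le_specRad hne hv.symm)
  simp only [Pi.zero_apply]
  linarith

lemma dotProduct_mulVec_comm (hM : M.IsSymm) (x y : Fin N → ℝ) :
    x ⬝ᵥ M *ᵥ y = M *ᵥ x ⬝ᵥ y := by
  rw [Matrix.dotProduct_mulVec, ← Matrix.mulVec_transpose, hM.eq]

/-- The norm of a symmetric matrix is at most its spectral radius. -/
lemma mulVec_dotProduct_self_le (hM : M.IsSymm) (x : Fin N → ℝ) :
    M *ᵥ x ⬝ᵥ M *ᵥ x ≤ specRad M ^ 2 * (x ⬝ᵥ x) := by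
  have hsymm : (M * M).IsSymm := by
    rw [Matrix.IsSymm, Matrix.transpose_mul, hM.eq]
  have hle : specRad (M * M) ≤ specRad M ^ 2 := by
    rcases Nat.eq_zero_or_pos N with h0 | hN
    · subst h0
      have : M = 0 := Subsingleton.elim _ _
      simp [this, specRad, spectralRadius, spectrum.of_subsingleton]
    obtain ⟨u, hu, μ, h, hμ⟩ := exists_abs_eq_specRad hN hsymm
    rw [← hμ]
    rw [← Matrix.mulVec_mulVec] at h
    rcases le_or_gt μ 0 with hneg | hpos
    · have h1 : M *ᵥ u ⬝ᵥ M *ᵥ u = μ * (u ⬝ᵥ u) := by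
        rw [← dotProduct_mulVec_comm hM, h, dotProduct_smul, smul_eq_mul]
      have h2 : 0 ≤ M *ᵥ u ⬝ᵥ M *ᵥ u := Finset.sum_nonneg fun i _ => mul_self_nonneg _
      have h3 : 0 < u ⬝ᵥ u := by
        refine lt_of_le_of_ne (Finset.sum_nonneg fun i _ => mul_self_nonneg _) fun h => hu ?_
        exact dotProduct_self_eq_zero.1 h.symm
      have : μ = 0 := by nlinarith
      rw [this, abs_zero]
      positivity
    · rw [abs_of_pos hpos]
      set ν := Real.sqrt μ with hν
      have hνμ : ν * ν = μ := Real.mul_self_sqrt hpos.le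
      have hν0 : 0 ≤ ν := Real.sqrt_nonneg _
      -- Since `(M - ν)(M + ν) u = 0`, either `u` is an eigenvector of `M` for `-ν`, or `M u + ν u`
      -- is one for `ν`.
      have key : ν ≤ specRad M := by
        by_cases hw : M *ᵥ u + ν • u = 0
        · have := abs_le_specRad (M := M) (μ := -ν) hu
            (by rw [neg_smul]; exact eq_neg_of_add_eq_zero_left hw)
          rwa [abs_neg, abs_of_nonneg hν0] at this
        · have := abs_le_specRad (M := M) (μ := ν) hw (by
            rw [Matrix.mulVec_add, Matrix.mulVec_smul, h, smul_add, smul_smul, hνμ, add_comm])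
          rwa [abs_of_nonneg hν0] at this
      nlinarith
  have := (posSemidef_smul_one_sub hsymm hle).dotProduct_mulVec_nonneg x
  rw [Matrix.sub_mulVec, Matrix.smul_mulVec, Matrix.one_mulVec, star_trivial, dotProduct_sub,
    dotProduct_smul, smul_eq_mul, ← Matrix.mulVec_mulVec, dotProduct_mulVec_comm hM] at this
  linarith

lemma dotProduct_pow_mulVec_le (hM : M.IsSymm) (m : ℕ) (x : Fin N → ℝ) :
    x ⬝ᵥ (M ^ (2 * m)) *ᵥ x ≤ specRad M ^ (2 * m) * (x ⬝ᵥ x) := by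
  have h1 : ∀ m : ℕ, (M ^ m) *ᵥ x ⬝ᵥ (M ^ m) *ᵥ x ≤ specRad M ^ (2 * m) * (x ⬝ᵥ x) := by
    intro m
    induction m with
    | zero => simp
    | succ m ih =>
      rw [pow_succ', ← Matrix.mulVec_mulVec]
      refine (mulVec_dotProduct_self_le hM _).trans ?_
      calc specRad M ^ 2 * ((M ^ m) *ᵥ x ⬝ᵥ (M ^ m) *ᵥ x)
          ≤ specRad M ^ 2 * (specRad M ^ (2 * m) * (x ⬝ᵥ x)) := by gcongr
        _ = _ := by ring
  have hs : (M ^ m).IsSymm := hM.pow m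
  rw [two_mul, pow_add, ← Matrix.mulVec_mulVec, dotProduct_mulVec_comm hs, ← two_mul]
  exact h1 m

lemma pow_mulVec_eigenvector {u : Fin N → ℝ} {μ : ℝ} (h : M *ᵥ u = μ • u) (k : ℕ) :
    (M ^ k) *ᵥ u = μ ^ k • u := by
  induction k with
  | zero => simp
  | succ k ih => rw [pow_succ, ← Matrix.mulVec_mulVec, h, Matrix.mulVec_smul, ih, smul_smul,
      pow_succ']

/-- Perron–Frobenius for a symmetric eventually positive matrix: an eigenvector whose eigenvalue has
maximal modulus has no zero entry and constant sign, and the eigenvalue is the spectral radius. -/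
lemma EventuallyPositive.peripheral_eigenvector (hM : M.IsSymm) (hP : EventuallyPositive M)
    {u : Fin N → ℝ} {μ : ℝ} (hu : u ≠ 0) (h : M *ᵥ u = μ • u) (hμ : |μ| = specRad M) :
    μ = specRad M ∧ ((∀ i, 0 < u i) ∨ ∀ i, u i < 0) := by
  suffices H : ∀ u : Fin N → ℝ, M *ᵥ u = μ • u → (∃ i, 0 < u i) →
      μ = specRad M ∧ ∀ i, 0 < u i by
    obtain ⟨i, hi⟩ := Function.ne_iff.1 hu
    rcases lt_or_gt_of_ne hi with hneg | hpos
    · have h' : M *ᵥ (-u) = μ • (-u) := by rw [Matrix.mulVec_neg, h, smul_neg]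
      obtain ⟨h1, h2⟩ := H (-u) h' ⟨i, by simpa using hneg⟩
      exact ⟨h1, Or.inr fun j => by simpa using h2 j⟩
    · obtain ⟨h1, h2⟩ := H u h ⟨i, hpos⟩
      exact ⟨h1, Or.inl h2⟩
  clear hu h u
  rintro u h ⟨i₀, hi₀⟩
  obtain ⟨m, hm, hpos⟩ := hP
  -- The even power makes `P u = ρ(M)^(2m) u` whatever the sign of `μ`.
  set P := M ^ (2 * m) with hPdef
  have hPpos : ∀ i j, 0 < P i j := hpos _ (by omega)
  have hPu : P *ᵥ u = specRad M ^ (2 * m) • u := by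
    rw [hPdef, pow_mulVec_eigenvector h, ← hμ, pow_mul, pow_mul, sq_abs]
  have expand : ∀ w : Fin N → ℝ, w ⬝ᵥ P *ᵥ w = ∑ i, ∑ j, P i j * (w i * w j) := by
    intro w
    simp only [dotProduct, Matrix.mulVec, Finset.mul_sum]
    exact Finset.sum_congr rfl fun i _ => Finset.sum_congr rfl fun j _ => by ring
  have habs : (fun i => |u i|) ⬝ᵥ (fun i => |u i|) = u ⬝ᵥ u := by
    simp [dotProduct]
  have hle := dotProduct_pow_mulVec_le hM m (fun i => |u i|)
  have heq : u ⬝ᵥ P *ᵥ u = specRad M ^ (2 * m) * (u ⬝ᵥ u) := by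
    rw [hPu, dotProduct_smul, smul_eq_mul]
  rw [habs, ← heq, ← hPdef, expand, expand] at hle
  have hterm : ∀ i j, 0 ≤ P i j * (|u i| * |u j|) - P i j * (u i * u j) := fun i j => by
    rw [← mul_sub, ← abs_mul]
    exact mul_nonneg (hPpos i j).le (sub_nonneg.2 (le_abs_self _))
  -- `|u|ᵀ P |u| ≤ ρ(M)^(2m) |u|² = uᵀ P u`, yet termwise the left side dominates the right.
  -- Equality in row `i₀` forces `u j = |u j|`.
  have hzero : ∑ i, ∑ j, (P i j * (|u i| * |u j|) - P i j * (u i * u j)) = 0 := by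
    refine le_antisymm ?_ (Finset.sum_nonneg fun i _ => Finset.sum_nonneg fun j _ => hterm i j)
    simp only [Finset.sum_sub_distrib]
    linarith
  have hu_nonneg : ∀ j, 0 ≤ u j := by
    intro j
    have h1 := (Finset.sum_eq_zero_iff_of_nonneg fun i _ =>
      Finset.sum_nonneg fun j _ => hterm i j).1 hzero i₀ (Finset.mem_univ _)
    have h2 := (Finset.sum_eq_zero_iff_of_nonneg fun j _ => hterm i₀ j).1 h1 j (Finset.mem_univ _)
    rw [← mul_sub, mul_eq_zero, abs_of_pos hi₀, ← mul_sub, mul_eq_zero, sub_eq_zero] at h2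
    rcases h2 with h2 | h2 | h2
    · exact absurd h2 (hPpos i₀ j).ne'
    · exact absurd h2 hi₀.ne'
    · exact h2 ▸ abs_nonneg _
  have hmul_pos : ∀ Q : Matrix (Fin N) (Fin N) ℝ, (∀ i j, 0 < Q i j) → ∀ i, 0 < (Q *ᵥ u) i :=
    fun Q hQ i => Finset.sum_pos' (fun j _ => mul_nonneg (hQ i j).le (hu_nonneg j))
      ⟨i₀, Finset.mem_univ _, mul_pos (hQ i i₀) hi₀⟩
  constructor
  · have h1 := hmul_pos (M ^ (2 * m + 1)) (hpos _ (by omega)) i₀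
    rw [pow_mulVec_eigenvector h, Pi.smul_apply, smul_eq_mul] at h1
    have hμ0 : 0 < μ := by
      by_contra hneg
      have h2 : μ ^ (2 * m + 1) ≤ 0 := (Odd.pow_nonpos_iff ⟨m, rfl⟩).2 (not_lt.1 hneg)
      linarith [mul_nonpos_of_nonpos_of_nonneg h2 hi₀.le]
    rw [← hμ, abs_of_pos hμ0]
  · intro i
    have h1 := hmul_pos P hPpos i
    rw [hPu, Pi.smul_apply, smul_eq_mul] at h1
    refine lt_of_le_of_ne (hu_nonneg i) fun h0 => ?_
    rw [← h0, mul_zero] at h1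
    exact lt_irrefl _ h1

lemma EventuallyPositive.exists_isPosRightEigenvector (hN : 0 < N) (hM : M.IsSymm)
    (hP : EventuallyPositive M) : ∃ v, IsPosRightEigenvector M v := by
  obtain ⟨u, hu, μ, h, hμ⟩ := exists_abs_eq_specRad hN hM
  obtain ⟨h1, h2 | h2⟩ := hP.peripheral_eigenvector hM hu h hμ
  · exact ⟨u, h2, h1 ▸ h⟩
  · refine ⟨-u, fun i => by simpa using h2 i, ?_⟩
    rw [Matrix.mulVec_neg, h, smul_neg, h1]

/-- Subtract the multiple of `v` that kills one entry: a nonzero eigenvector for `ρ(M)` has no zero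
entry. -/
lemma EventuallyPositive.eq_smul_of_mulVec_eq (hN : 0 < N) (hM : M.IsSymm)
    (hP : EventuallyPositive M) {v u : Fin N → ℝ} (hv : IsPosRightEigenvector M v)
    (hu : M *ᵥ u = specRad M • u) : ∃ c : ℝ, u = c • v := by
  let i₀ : Fin N := ⟨0, hN⟩
  refine ⟨u i₀ / v i₀, ?_⟩
  by_contra hne
  have hzero : (u - (u i₀ / v i₀) • v) i₀ = 0 := by
    simp [div_mul_cancel₀ _ (hv.1 i₀).ne']
  obtain ⟨-, h | h⟩ := hP.peripheral_eigenvector hM (μ := specRad M) (sub_ne_zero.2 hne)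
    (by rw [Matrix.mulVec_sub, Matrix.mulVec_smul, hu, hv.2, smul_sub, smul_comm])
    (abs_of_nonneg specRad_nonneg)
  · exact (h i₀).ne' hzero
  · exact (h i₀).ne hzero

end SpectralRadius

/-! ### Global existence of solutions -/

section GlobalExistence

/-- A bounded Lipschitz autonomous vector field has a forward solution for all times. -/
theorem exists_forward_solution_of_bounded_lipschitz {F : Type*} [NormedAddCommGroup F]
    [NormedSpace ℝ F] [CompleteSpace F] {f : F → F} {K L : NNReal} (hK : LipschitzWith K f)
    (hL : ∀ z, ‖f z‖ ≤ L) (z₀ : F) :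
    ∃ z : ℝ → F, z 0 = z₀ ∧ ∀ t, 0 ≤ t → HasDerivWithinAt z (f (z t)) (Ici 0) t := by
  have hlocal : ∀ n : ℕ, ∃ z : ℝ → F, z 0 = z₀ ∧
      ∀ t ∈ Icc (0 : ℝ) n, HasDerivWithinAt z (f (z t)) (Icc 0 n) t := by
    intro n
    have h0 : (0 : ℝ) ∈ Icc (0 : ℝ) n := ⟨le_rfl, n.cast_nonneg⟩
    -- At speed at most `L` the ball of radius `L n` cannot be left before time `n`, so one Picard
    -- step covers `[0, n]`.
    exact IsPicardLindelof.exists_eq_forall_mem_Icc_hasDerivWithinAt₀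
      (t₀ := ⟨0, h0⟩) (f := fun _ => f) (a := L * n)
      (IsPicardLindelof.of_time_independent (fun x _ => hL x) hK.lipschitzOnWith (by simp))
  choose z hz0 hz using hlocal
  have hright : ∀ (n : ℕ) {t : ℝ}, t ∈ Ico (0 : ℝ) n →
      HasDerivWithinAt (z n) (f (z n t)) (Ici 0) t := by
    intro n t ht
    refine (hz n t (Ico_subset_Icc_self ht)).mono_of_mem_nhdsWithin ?_
    rw [← Ici_inter_Iic]
    exact inter_mem self_mem_nhdsWithin (mem_nhdsWithin_of_mem_nhds (Iic_mem_nhds ht.2))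
  have heq : ∀ m n : ℕ, m ≤ n → EqOn (z m) (z n) (Icc 0 m) := by
    intro m n hmn
    have hcast : (m : ℝ) ≤ n := Nat.cast_le.2 hmn
    refine ODE_solution_unique (v := fun _ => f) (fun _ => hK)
      (fun t ht => (hz m t ht).continuousWithinAt) (fun t ht => ?_)
      (fun t ht => ((hz n t ⟨ht.1, ht.2.trans hcast⟩).mono
        (Icc_subset_Icc_right hcast)).continuousWithinAt) (fun t ht => ?_)
      ((hz0 m).trans (hz0 n).symm)
    · exact (hright m ht).mono (Ici_subset_Ici.2 ht.1)
    · exact (hright n ⟨ht.1, ht.2.trans_le hcast⟩).mono (Ici_subset_Ici.2 ht.1)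
  have hglue : ∀ (n : ℕ) {t : ℝ}, t ∈ Ico (0 : ℝ) n → z (⌊t⌋₊ + 1) t = z n t := by
    intro n t ht
    have hlt : ⌊t⌋₊ < n := (Nat.floor_lt ht.1).2 ht.2
    refine heq _ _ hlt ⟨ht.1, ?_⟩
    push_cast
    exact (Nat.lt_floor_add_one t).le
  -- The `+ 1` keeps `t` strictly below the right endpoint, so the derivative within `Ici 0` is
  -- available.
  refine ⟨fun t => z (⌊t⌋₊ + 1) t, by simp [hz0], fun t ht => ?_⟩
  have htn : t ∈ Ico (0 : ℝ) ((⌊t⌋₊ + 1 : ℕ) : ℝ) := ⟨ht, by push_cast; exact Nat.lt_floor_add_one t⟩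
  refine (hright _ htn).congr_of_eventuallyEq ?_ rfl
  filter_upwards [self_mem_nhdsWithin, mem_nhdsWithin_of_mem_nhds (Iio_mem_nhds htn.2)] with s h1 h2
  exact hglue _ ⟨h1, h2⟩

end GlobalExistence

lemma Real.hasDerivAt_tanh (s : ℝ) : HasDerivAt Real.tanh (1 - Real.tanh s ^ 2) s := by
  have h := (Real.hasDerivAt_sinh s).div (Real.hasDerivAt_cosh s) (Real.cosh_pos s).ne'
  have he : Real.tanh = Real.sinh / Real.cosh := by
    ext t
    exact Real.tanh_eq_sinh_div_cosh t
  rw [he]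
  refine h.congr_deriv ?_
  have := (Real.cosh_pos s).ne'
  rw [Pi.div_apply]
  field_simp

lemma Real.lipschitzWith_tanh : LipschitzWith 1 Real.tanh := by
  refine lipschitzWith_of_nnnorm_deriv_le (fun s => (Real.hasDerivAt_tanh s).differentiableAt)
    fun s => ?_
  rw [(Real.hasDerivAt_tanh s).deriv, ← NNReal.coe_le_coe, coe_nnnorm, Real.norm_eq_abs,
    NNReal.coe_one, abs_le]
  have := Real.tanh_sq_lt_one s
  constructor <;> nlinarith [sq_nonneg (Real.tanh s)]

section Existence

open scoped Matrix

variable {N : ℕ}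

lemma opinionField_apply (a : Fin N → ℝ → ℝ) (E : Matrix (Fin N) (Fin N) ℝ) (x : Fin N → ℝ)
    (i : Fin N) : opinionField a E x i = a i (x i) * (E *ᵥ x) i := by
  rw [opinionField, Matrix.mulVec_diagonal]

/-- Initial states in which the agents of `I` are frozen at `±1`, and the others are strictly inside
`(-1, 1)`. -/
def IsFrozenState (I : Finset (Fin N)) (x : Fin N → ℝ) : Prop :=
  (∀ i ∈ I, x i ^ 2 = 1) ∧ ∀ i ∉ I, x i ∈ Ioo (-1 : ℝ) 1

/-- As `tanh' = 1 - tanh²`, setting `x_i = tanh z_i` at free agents absorbs the susceptibility: `z'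
= E X(z)` has a bounded, globally Lipschitz right-hand side. -/
theorem exists_isSolution (E : Matrix (Fin N) (Fin N) ℝ) {I : Finset (Fin N)} {x₀ : Fin N → ℝ}
    (h₀ : IsFrozenState I x₀) : ∃ x, IsSolution stubbornExtremists E x ∧ x 0 = x₀ := by
  classical
  let X : (Fin N → ℝ) → Fin N → ℝ := fun z i => if i ∈ I then x₀ i else Real.tanh (z i)
  let Φ : (Fin N → ℝ) →L[ℝ] (Fin N → ℝ) := LinearMap.toContinuousLinearMap E.mulVecLin
  have hX : LipschitzWith 1 X := by
    refine LipschitzWith.of_dist_le_mul fun z w => (dist_pi_le_iff (by positivity)).2 fun i => ?_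
    by_cases hi : i ∈ I
    · simp only [X, hi, if_true, dist_self]
      positivity
    · simp only [X, hi, if_false]
      refine (Real.lipschitzWith_tanh.dist_le_mul _ _).trans ?_
      gcongr
      exact dist_le_pi_dist z w i
  have hXle : ∀ z, ‖X z‖ ≤ 1 := fun z => (pi_norm_le_iff_of_nonneg zero_le_one).2 fun i => by
    by_cases hi : i ∈ I
    · simp only [X, hi, if_true, Real.norm_eq_abs]
      exact (sq_le_one_iff_abs_le_one _).1 (h₀.1 i hi).le
    · simp only [X, hi, if_false, Real.norm_eq_abs]
      exact (Real.abs_tanh_lt_one _).le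
  obtain ⟨z, hz0, hz⟩ := exists_forward_solution_of_bounded_lipschitz (f := fun z => Φ (X z))
    (L := ‖Φ‖₊) (Φ.lipschitz.comp hX)
    (fun z => (Φ.le_opNorm _).trans (mul_le_of_le_one_right (norm_nonneg _) (hXle z)))
    -- The value at frozen agents is irrelevant, because `X` ignores those coordinates.
    (fun i => Real.artanh (x₀ i))
  refine ⟨fun t => X (z t), fun t ht => hasDerivWithinAt_pi.2 fun i => ?_, ?_⟩
  · rw [opinionField_apply]
    by_cases hi : i ∈ I
    · simp only [X, hi, if_true, stubbornExtremists, h₀.1 i hi, sub_self, zero_mul]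
      exact hasDerivWithinAt_const _ _ _
    · have h := (Real.hasDerivAt_tanh (z t i)).comp_hasDerivWithinAt t
        (hasDerivWithinAt_pi.1 (hz t ht) i)
      have hfun : (fun s => X (z s) i) = Real.tanh ∘ fun s => z s i := by
        funext s
        simp [X, hi]
      rw [hfun]
      refine h.congr_deriv ?_
      simp [X, hi, stubbornExtremists, Φ]
  · ext i
    by_cases hi : i ∈ I
    · simp [X, hi]
    · simp [X, hi, hz0, Real.tanh_artanh (h₀.2 i hi)]

end Existence

/-! ### Scalar equations and limits on the half-line -/

section HalfLine

variable {f f' F W : ℝ → ℝ}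

lemma antitoneOn_Ici_of_hasDerivWithinAt
    (hf : ∀ t, 0 ≤ t → HasDerivWithinAt f (f' t) (Ici 0) t) (hf' : ∀ t, 0 ≤ t → f' t ≤ 0) :
    AntitoneOn f (Ici 0) := by
  refine antitoneOn_of_hasDerivWithinAt_nonpos (f' := f') (convex_Ici 0)
    (fun t ht => (hf t ht).continuousWithinAt) (fun t ht => ?_) (fun t ht => ?_)
  · exact (hf t (interior_subset ht)).mono interior_subset
  · exact hf' t (interior_subset ht)

lemma eq_of_hasDerivWithinAt_zero (hf : ∀ t, 0 ≤ t → HasDerivWithinAt f 0 (Ici 0) t) {t : ℝ}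
    (ht : 0 ≤ t) : f t = f 0 := by
  refine le_antisymm
    (antitoneOn_Ici_of_hasDerivWithinAt hf (fun _ _ => le_rfl) (mem_Ici.2 le_rfl) ht ht) ?_
  have := antitoneOn_Ici_of_hasDerivWithinAt (f := fun t => -f t) (fun t ht => (hf t ht).neg)
    (fun _ _ => by simp) (mem_Ici.2 le_rfl) ht ht
  exact neg_le_neg_iff.1 this

/-- A solution of a scalar linear equation is its initial value times a positive function. -/
lemma exists_eq_mul_exp {u h : ℝ → ℝ} (hh : ContinuousOn h (Ici 0))
    (hu : ∀ t, 0 ≤ t → HasDerivWithinAt u (h t * u t) (Ici 0) t) :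
    ∃ G : ℝ → ℝ, ∀ t, 0 ≤ t → u t = u 0 * Real.exp (G t) := by
  -- Extending `h` constantly to negative times gives an antiderivative with a two-sided derivative.
  have hcont : Continuous fun s => h (max s 0) :=
    hh.comp_continuous (by fun_prop) fun s => mem_Ici.2 (le_max_right _ _)
  refine ⟨fun t => ∫ s in (0 : ℝ)..t, h (max s 0), fun t ht => ?_⟩
  have hG : ∀ t, HasDerivAt (fun t => ∫ s in (0 : ℝ)..t, h (max s 0)) (h (max t 0)) t :=
    fun t => (hcont.integral_hasStrictDerivAt 0 t).hasDerivAt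
  have hconst := eq_of_hasDerivWithinAt_zero
    (f := fun t => u t * Real.exp (-∫ s in (0 : ℝ)..t, h (max s 0))) (fun t ht => by
      have := (hu t ht).mul (hG t).neg.exp.hasDerivWithinAt
      refine this.congr_deriv ?_
      rw [max_eq_left ht]
      ring) ht
  simp only [intervalIntegral.integral_same, neg_zero, Real.exp_zero, mul_one] at hconst
  rw [← hconst, mul_assoc, ← Real.exp_add, neg_add_cancel, Real.exp_zero, mul_one]

/-- If `F` is nonnegative and nonincreasing, and `-F` is the derivative of a function bounded below,
then `F` tends to `0`. -/
lemma tendsto_zero_of_antitoneOn_of_hasDerivWithinAt_neg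
    (hW : ∀ t, 0 ≤ t → HasDerivWithinAt W (-F t) (Ici 0) t) (hW0 : ∀ t, 0 ≤ t → 0 ≤ W t)
    (hF : AntitoneOn F (Ici 0)) (hF0 : ∀ t, 0 ≤ t → 0 ≤ F t) : Tendsto F atTop (𝓝 0) := by
  have hle : ∀ t, 0 < t → F t ≤ W 0 / t := by
    intro t ht
    -- For `s ≤ t` the derivative `-F s + F t` is nonpositive; comparing endpoints gives `t F(t) ≤
    -- W(0)`.
    have hanti : AntitoneOn (fun s => W s + s * F t) (Icc 0 t) := by
      refine antitoneOn_of_hasDerivWithinAt_nonpos (f' := fun s => -F s + 1 * F t) (convex_Icc 0 t)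
        (fun s hs => ?_) (fun s hs => ?_) (fun s hs => ?_)
      · exact ((hW s hs.1).continuousWithinAt.mono Icc_subset_Ici_self).add (by fun_prop)
      · have hs' := interior_subset hs
        exact ((hW s hs'.1).mono (interior_subset.trans Icc_subset_Ici_self)).add
          ((hasDerivWithinAt_id _ _).mul_const _)
      · have hs' := interior_subset hs
        have := hF (mem_Ici.2 hs'.1) (mem_Ici.2 ht.le) hs'.2
        linarith
    have h1 := hanti (left_mem_Icc.2 ht.le) (right_mem_Icc.2 ht.le) ht.le
    simp only [zero_mul, add_zero] at h1
    rw [le_div_iff₀ ht, mul_comm]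
    linarith [hW0 t ht.le]
  refine tendsto_of_tendsto_of_tendsto_of_le_of_le' tendsto_const_nhds
    ((tendsto_const_nhds (x := W 0)).div_atTop tendsto_id) ?_ ?_
  · filter_upwards [eventually_ge_atTop 0] with t ht using hF0 t ht
  · filter_upwards [eventually_gt_atTop 0] with t ht using hle t ht

lemma MapClusterPt.eq_of_tendsto_comp {α X Y : Type*} [TopologicalSpace X] [TopologicalSpace Y]
    [T2Space Y] {l : Filter α} {x : α → X} {q : X} {g : X → Y} {y : Y} (hq : MapClusterPt q l x)
    (hg : ContinuousAt g q) (ht : Tendsto (fun t => g (x t)) l (𝓝 y)) : g q = y := by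
  have h1 : ClusterPt (g q) (𝓝 y) := (hq.continuousAt_comp hg).clusterPt.mono ht
  have : (𝓝 (g q) ⊓ 𝓝 y).NeBot := h1
  exact eq_of_nhds_neBot this

end HalfLine

/-! ### Logarithmic barriers -/

section Barrier

/-- The barrier function of the interval `(-1, 1)` with minimum at `a`; its derivative at `s` is
`(s - a) / (1 - s²)`. -/
noncomputable def barrier (a s : ℝ) : ℝ :=
  Real.log 2 - (1 - a) / 2 * Real.log (1 - s) - (1 + a) / 2 * Real.log (1 + s)

/-- The weights `(1 ∓ a) / 2` are nonnegative with sum `1`, and `1 ∓ s ≤ 2`; hence the constant `log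
2`. -/
lemma barrier_nonneg {a s : ℝ} (ha : a ∈ Ioo (-1 : ℝ) 1) (hs : s ∈ Ioo (-1 : ℝ) 1) :
    0 ≤ barrier a s := by
  obtain ⟨ha1, ha2⟩ := ha
  obtain ⟨hs1, hs2⟩ := hs
  have h1 : Real.log (1 - s) ≤ Real.log 2 := Real.log_le_log (by linarith) (by linarith)
  have h2 : Real.log (1 + s) ≤ Real.log 2 := Real.log_le_log (by linarith) (by linarith)
  have h3 : (1 - a) / 2 * Real.log (1 - s) ≤ (1 - a) / 2 * Real.log 2 :=
    mul_le_mul_of_nonneg_left h1 (by linarith)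
  have h4 : (1 + a) / 2 * Real.log (1 + s) ≤ (1 + a) / 2 * Real.log 2 :=
    mul_le_mul_of_nonneg_left h2 (by linarith)
  rw [barrier]
  linarith

lemma HasDerivWithinAt.barrier {a t g : ℝ} {y : ℝ → ℝ} {S : Set ℝ} (hy : y t ∈ Ioo (-1 : ℝ) 1)
    (h : HasDerivWithinAt y ((1 - y t ^ 2) * g) S t) :
    HasDerivWithinAt (fun s => barrier a (y s)) ((y t - a) * g) S t := by
  obtain ⟨h1, h2⟩ := hy
  have h3 : 1 - y t ≠ 0 := by linarith
  have h4 : 1 + y t ≠ 0 := by linarith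
  have := (((h.const_sub 1).log h3).const_mul ((1 - a) / 2)).const_sub (Real.log 2) |>.sub
    (((h.const_add 1).log h4).const_mul ((1 + a) / 2))
  refine this.congr_deriv ?_
  field_simp
  ring

end Barrier

/-! ### Lyapunov argument and cluster points -/

section Convergence

open scoped Matrix

variable {N : ℕ} {E : Matrix (Fin N) (Fin N) ℝ} {I : Finset (Fin N)} {p : Fin N → ℝ}
  {x : ℝ → Fin N → ℝ}

lemma HasDerivWithinAt.mulVec {y : ℝ → Fin N → ℝ} {y' : Fin N → ℝ} {S : Set ℝ} {t : ℝ}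
    (h : HasDerivWithinAt y y' S t) :
    HasDerivWithinAt (fun s => E *ᵥ y s) (E *ᵥ y') S t :=
  (LinearMap.toContinuousLinearMap E.mulVecLin).hasFDerivAt.comp_hasDerivWithinAt t h

lemma HasDerivWithinAt.dotProduct {y z : ℝ → Fin N → ℝ} {y' z' : Fin N → ℝ} {S : Set ℝ} {t : ℝ}
    (hy : HasDerivWithinAt y y' S t) (hz : HasDerivWithinAt z z' S t) :
    HasDerivWithinAt (fun s => y s ⬝ᵥ z s) (y' ⬝ᵥ z t + y t ⬝ᵥ z') S t := by
  have := HasDerivWithinAt.fun_sum (u := Finset.univ) fun i _ =>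
    (hasDerivWithinAt_pi.1 hy i).mul (hasDerivWithinAt_pi.1 hz i)
  rw [Finset.sum_add_distrib] at this
  exact this

namespace IsSolution

lemma continuousOn (hx : IsSolution stubbornExtremists E x) : ContinuousOn x (Ici 0) :=
  fun t ht => (hx t ht).continuousWithinAt

lemma hasDerivWithinAt_apply (hx : IsSolution stubbornExtremists E x) {t : ℝ} (ht : 0 ≤ t)
    (i : Fin N) :
    HasDerivWithinAt (fun s => x s i) ((1 - x t i ^ 2) * (E *ᵥ x t) i) (Ici 0) t := by
  have := hasDerivWithinAt_pi.1 (hx t ht) i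
  rwa [opinionField_apply] at this

/-- Agents at `±1` stay there, and the others stay in `(-1, 1)`. -/
theorem frozen_or_mem_Ioo (hx : IsSolution stubbornExtremists E x) (h₀ : IsFrozenState I (x 0))
    {t : ℝ} (ht : 0 ≤ t) : (∀ i ∈ I, x t i = x 0 i) ∧ ∀ i ∉ I, x t i ∈ Ioo (-1 : ℝ) 1 := by
  have hE : ∀ i, ContinuousOn (fun t => (E *ᵥ x t) i) (Ici 0) := fun i =>
    (continuous_apply i).comp_continuousOn
      ((LinearMap.toContinuousLinearMap E.mulVecLin).continuous.comp_continuousOn hx.continuousOn)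
  have hxi : ∀ i, ContinuousOn (fun t => x t i) (Ici 0) := fun i =>
    (continuous_apply i).comp_continuousOn hx.continuousOn
  -- `1 - x_i` and `1 + x_i` solve scalar linear equations, so each is identically zero or keeps its
  -- sign.
  have hupper : ∀ i, ∃ G : ℝ → ℝ, ∀ t, 0 ≤ t → 1 - x t i = (1 - x 0 i) * Real.exp (G t) := fun i =>
    exists_eq_mul_exp (u := fun t => 1 - x t i) (h := fun t => -((1 + x t i) * (E *ᵥ x t) i))
      (((continuousOn_const.add (hxi i)).mul (hE i)).neg)
      fun t ht => ((hx.hasDerivWithinAt_apply ht i).const_sub 1).congr_deriv (by ring)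
  have hlower : ∀ i, ∃ G : ℝ → ℝ, ∀ t, 0 ≤ t → 1 + x t i = (1 + x 0 i) * Real.exp (G t) := fun i =>
    exists_eq_mul_exp (u := fun t => 1 + x t i) (h := fun t => (1 - x t i) * (E *ᵥ x t) i)
      ((continuousOn_const.sub (hxi i)).mul (hE i))
      fun t ht => ((hx.hasDerivWithinAt_apply ht i).const_add 1).congr_deriv (by ring)
  refine ⟨fun i hi => ?_, fun i hi => ?_⟩
  · obtain ⟨G, hG⟩ := hupper i
    obtain ⟨H, hH⟩ := hlower i
    rcases eq_or_eq_neg_of_sq_eq_sq _ _ ((h₀.1 i hi).trans (one_pow 2).symm) with h | h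
    · have := hG t ht
      rw [h, sub_self, zero_mul] at this
      linarith
    · have := hH t ht
      rw [h, add_neg_cancel, zero_mul] at this
      linarith
  · obtain ⟨G, hG⟩ := hupper i
    obtain ⟨H, hH⟩ := hlower i
    obtain ⟨h1, h2⟩ := h₀.2 i hi
    have h3 : 0 < 1 - x t i := hG t ht ▸ mul_pos (by linarith) (Real.exp_pos _)
    have h4 : 0 < 1 + x t i := hH t ht ▸ mul_pos (by linarith) (Real.exp_pos _)
    exact ⟨by linarith, by linarith⟩

lemma one_sub_sq_nonneg (hx : IsSolution stubbornExtremists E x) (h₀ : IsFrozenState I (x 0))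
    {t : ℝ} (ht : 0 ≤ t) (i : Fin N) : 0 ≤ 1 - x t i ^ 2 := by
  by_cases hi : i ∈ I
  · rw [(hx.frozen_or_mem_Ioo h₀ ht).1 i hi, h₀.1 i hi, sub_self]
  · obtain ⟨h1, h2⟩ := (hx.frozen_or_mem_Ioo h₀ ht).2 i hi
    nlinarith

/-- Relative to a reduced equilibrium `p`, the velocity depends on `x - p` only through
`E (x - p)`. -/
lemma hasDerivWithinAt_sub_apply (hx : IsSolution stubbornExtremists E x)
    (h₀ : IsFrozenState I (x 0)) (hp : ∀ i ∉ I, (E *ᵥ p) i = 0) {t : ℝ} (ht : 0 ≤ t) (i : Fin N) :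
    HasDerivWithinAt (fun s => x s i) ((1 - x t i ^ 2) * (E *ᵥ (x t - p)) i) (Ici 0) t := by
  refine (hx.hasDerivWithinAt_apply ht i).congr_deriv ?_
  by_cases hi : i ∈ I
  · rw [(hx.frozen_or_mem_Ioo h₀ ht).1 i hi, h₀.1 i hi, sub_self, zero_mul, zero_mul]
  · rw [Matrix.mulVec_sub, Pi.sub_apply, hp i hi, sub_zero]

/-- The sum of the barriers of the free agents is a Lyapunov function. -/
theorem hasDerivWithinAt_sum_barrier (hx : IsSolution stubbornExtremists E x)
    (h₀ : IsFrozenState I (x 0)) (hpI : ∀ i ∈ I, x 0 i = p i) (hp : ∀ i ∉ I, (E *ᵥ p) i = 0)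
    {t : ℝ} (ht : 0 ≤ t) :
    HasDerivWithinAt (fun s => ∑ i ∈ Iᶜ, barrier (p i) (x s i))
      ((x t - p) ⬝ᵥ E *ᵥ (x t - p)) (Ici 0) t := by
  have h := HasDerivWithinAt.fun_sum (u := Iᶜ) fun i hi =>
    HasDerivWithinAt.barrier (a := p i)
      ((hx.frozen_or_mem_Ioo h₀ ht).2 i (Finset.mem_compl.1 hi))
      (hx.hasDerivWithinAt_sub_apply h₀ hp ht i)
  refine h.congr_deriv ?_
  refine Finset.sum_subset (Finset.subset_univ _) fun i _ hi => ?_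
  rw [Finset.mem_compl, not_not] at hi
  rw [(hx.frozen_or_mem_Ioo h₀ ht).1 i hi, hpI i hi, sub_self, zero_mul]

/-- The form increases along solutions, by symmetry of `E` and `1 - x_i² ≥ 0`, and it is the
derivative of the nonnegative barrier sum. -/
theorem tendsto_quadratic_form (hE : E.IsSymm) (hneg : ∀ y, y ⬝ᵥ E *ᵥ y ≤ 0)
    (hx : IsSolution stubbornExtremists E x) (h₀ : IsFrozenState I (x 0))
    (hpI : ∀ i ∈ I, x 0 i = p i) (hpF : ∀ i ∉ I, p i ∈ Ioo (-1 : ℝ) 1)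
    (hp : ∀ i ∉ I, (E *ᵥ p) i = 0) :
    Tendsto (fun t => (x t - p) ⬝ᵥ E *ᵥ (x t - p)) atTop (𝓝 0) := by
  have hanti : AntitoneOn (fun t => -((x t - p) ⬝ᵥ E *ᵥ (x t - p))) (Ici 0) := by
    refine antitoneOn_Ici_of_hasDerivWithinAt
      (f' := fun t => -(2 * ∑ i, (1 - x t i ^ 2) * (E *ᵥ (x t - p)) i ^ 2))
      (fun t ht => ?_) (fun t ht => ?_)
    · have hd : HasDerivWithinAt (fun s => x s - p)
          (fun i => (1 - x t i ^ 2) * (E *ᵥ (x t - p)) i) (Ici 0) t :=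
        (hasDerivWithinAt_pi.2 fun i => hx.hasDerivWithinAt_sub_apply h₀ hp ht i).sub_const p
      refine (hd.dotProduct hd.mulVec).neg.congr_deriv ?_
      rw [dotProduct_mulVec_comm hE (x t - p), dotProduct_comm (E *ᵥ (x t - p)), ← two_mul, dotProduct]
      congr 2
      exact Finset.sum_congr rfl fun i _ => by ring
    · exact neg_nonpos.2 (mul_nonneg zero_le_two (Finset.sum_nonneg fun i _ =>
        mul_nonneg (hx.one_sub_sq_nonneg h₀ ht i) (sq_nonneg _)))
  have h := tendsto_zero_of_antitoneOn_of_hasDerivWithinAt_neg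
    (W := fun s => ∑ i ∈ Iᶜ, barrier (p i) (x s i))
    (fun t ht => (hx.hasDerivWithinAt_sum_barrier h₀ hpI hp ht).congr_deriv (neg_neg _).symm)
    (fun t ht => Finset.sum_nonneg fun i hi =>
      barrier_nonneg (hpF i (Finset.mem_compl.1 hi))
        ((hx.frozen_or_mem_Ioo h₀ ht).2 i (Finset.mem_compl.1 hi)))
    hanti (fun t _ => neg_nonneg.2 (hneg _))
  simpa using h.neg

/-- Cluster points of a trajectory are zeros of the quadratic form centred at a reduced equilibrium
with the same frozen agents. -/
theorem quadratic_form_eq_zero_of_mapClusterPt (hE : E.IsSymm) (hneg : ∀ y, y ⬝ᵥ E *ᵥ y ≤ 0)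
    (hx : IsSolution stubbornExtremists E x) (h₀ : IsFrozenState I (x 0))
    (hpI : ∀ i ∈ I, x 0 i = p i) (hpF : ∀ i ∉ I, p i ∈ Ioo (-1 : ℝ) 1)
    (hp : ∀ i ∉ I, (E *ᵥ p) i = 0) {q : Fin N → ℝ} (hq : MapClusterPt q atTop x) :
    (∀ i ∈ I, q i = p i) ∧ (q - p) ⬝ᵥ E *ᵥ (q - p) = 0 := by
  constructor
  · intro i hi
    refine hq.eq_of_tendsto_comp (continuous_apply i).continuousAt
      (tendsto_const_nhds.congr' ?_)
    filter_upwards [eventually_ge_atTop 0] with t ht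
    rw [(hx.frozen_or_mem_Ioo h₀ ht).1 i hi, hpI i hi]
  · refine hq.eq_of_tendsto_comp (g := fun q => (q - p) ⬝ᵥ E *ᵥ (q - p)) ?_
      (hx.tendsto_quadratic_form hE hneg h₀ hpI hpF hp)
    have : Continuous fun q : Fin N → ℝ => (q - p) ⬝ᵥ E *ᵥ (q - p) := by fun_prop
    exact this.continuousAt

lemma mem_Icc (hx : IsSolution stubbornExtremists E x) (h₀ : IsFrozenState I (x 0)) {t : ℝ}
    (ht : 0 ≤ t) : x t ∈ Icc (-1 : Fin N → ℝ) 1 := by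
  have h := fun i => abs_le.1 ((sq_le_one_iff_abs_le_one _).1
    (sub_nonneg.1 (hx.one_sub_sq_nonneg h₀ ht i)))
  exact ⟨fun i => (h i).1, fun i => (h i).2⟩

end IsSolution

/-- Convergence to a reduced equilibrium `p` on whose frozen agents the quadratic form of `E` is
definite. -/
theorem solutionsTendTo_of_definite (hE : E.IsSymm) (hneg : ∀ y, y ⬝ᵥ E *ᵥ y ≤ 0)
    (hpI : ∀ i ∈ I, p i ^ 2 = 1) (hpF : ∀ i ∉ I, p i ∈ Ioo (-1 : ℝ) 1)
    (hp : ∀ i ∉ I, (E *ᵥ p) i = 0)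
    (hdef : ∀ y : Fin N → ℝ, (∀ i ∈ I, y i = 0) → y ⬝ᵥ E *ᵥ y = 0 → y = 0) {x₀ : Fin N → ℝ}
    (hx₀I : ∀ i ∈ I, x₀ i = p i) (hx₀F : ∀ i ∉ I, x₀ i ∈ Ioo (-1 : ℝ) 1) :
    SolutionsTendTo stubbornExtremists E x₀ p := by
  have h₀ : IsFrozenState I x₀ := ⟨fun i hi => by rw [hx₀I i hi, hpI i hi], hx₀F⟩
  refine ⟨exists_isSolution E h₀, fun x hx hx0 => ?_⟩
  subst hx0
  refine isCompact_Icc.tendsto_nhds_of_unique_mapClusterPt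
    ((eventually_ge_atTop 0).mono fun t ht => hx.mem_Icc h₀ ht) fun q _ hq => ?_
  obtain ⟨h1, h2⟩ := hx.quadratic_form_eq_zero_of_mapClusterPt hE hneg h₀ hx₀I hpF hp hq
  exact sub_eq_zero.1 (hdef _ (fun i hi => by rw [Pi.sub_apply, h1 i hi, sub_self]) h2)

end Convergence

/-! ### Kernel of `M - c I` and the definite cases -/

section DefiniteCase

open scoped Matrix

variable {N : ℕ} {M : Matrix (Fin N) (Fin N) ℝ} {c : ℝ}

lemma isSymm_sub_smul_one (hM : M.IsSymm) (c : ℝ) :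
    (M - c • (1 : Matrix (Fin N) (Fin N) ℝ)).IsSymm := by
  rw [Matrix.IsSymm, Matrix.transpose_sub, hM.eq, Matrix.transpose_smul, Matrix.transpose_one]

lemma dotProduct_sub_smul_one_mulVec_nonpos (hM : M.IsSymm) (hc : specRad M ≤ c)
    (y : Fin N → ℝ) : y ⬝ᵥ (M - c • (1 : Matrix (Fin N) (Fin N) ℝ)) *ᵥ y ≤ 0 := by
  have := (posSemidef_smul_one_sub hM hc).dotProduct_mulVec_nonneg y
  rw [star_trivial, ← neg_sub, Matrix.neg_mulVec, dotProduct_neg] at this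
  linarith

lemma sub_smul_one_mulVec_eq_zero (hM : M.IsSymm) (hc : specRad M ≤ c) {y : Fin N → ℝ}
    (hy : y ⬝ᵥ (M - c • (1 : Matrix (Fin N) (Fin N) ℝ)) *ᵥ y = 0) :
    (M - c • (1 : Matrix (Fin N) (Fin N) ℝ)) *ᵥ y = 0 := by
  have := ((posSemidef_smul_one_sub hM hc).dotProduct_mulVec_zero_iff y).1 (by
    rw [star_trivial, ← neg_sub, Matrix.neg_mulVec, dotProduct_neg, hy, neg_zero])
  rwa [← neg_sub, Matrix.neg_mulVec, neg_eq_zero] at this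

lemma sub_smul_one_mulVec_eq_zero_iff (y : Fin N → ℝ) :
    (M - c • (1 : Matrix (Fin N) (Fin N) ℝ)) *ᵥ y = 0 ↔ M *ᵥ y = c • y := by
  rw [Matrix.sub_mulVec, Matrix.smul_mulVec, Matrix.one_mulVec, sub_eq_zero]

lemma IsPosRightEigenvector.norm_pos (hN : 0 < N) {v : Fin N → ℝ}
    (hv : IsPosRightEigenvector M v) : 0 < ‖v‖ :=
  norm_pos_iff.2 fun h => (hv.1 ⟨0, hN⟩).ne' (congrFun h _)

lemma IsPosRightEigenvector.exists_eq_norm (hN : 0 < N) {v : Fin N → ℝ}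
    (hv : IsPosRightEigenvector M v) : ∃ i, v i = ‖v‖ := by
  have : Nonempty (Fin N) := ⟨⟨0, hN⟩⟩
  obtain ⟨i, hi⟩ := Finite.exists_max v
  refine ⟨i, le_antisymm ((le_abs_self _).trans (norm_le_pi_norm v i)) ?_⟩
  refine (pi_norm_le_iff_of_nonneg (hv.1 i).le).2 fun j => ?_
  rw [Real.norm_eq_abs, abs_of_pos (hv.1 j)]
  exact hi j

/-- A nonzero kernel vector would be an eigenvector of `M` for `c > ρ(M)`. -/
lemma solutionsTendTo_zero (hM : M.IsSymm) (hc : specRad M < c) {x₀ : Fin N → ℝ}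
    (hx₀ : ∀ i, x₀ i ∈ Ioo (-1 : ℝ) 1) :
    SolutionsTendTo stubbornExtremists (M - c • (1 : Matrix (Fin N) (Fin N) ℝ)) x₀ 0 := by
  refine solutionsTendTo_of_definite (I := ∅) (isSymm_sub_smul_one hM c)
    (dotProduct_sub_smul_one_mulVec_nonpos hM hc.le) (by simp) (by simp) (by simp)
    (fun y _ hy => ?_) (by simp) (fun i _ => hx₀ i)
  by_contra h0
  have := abs_le_specRad h0
    ((sub_smul_one_mulVec_eq_zero_iff y).1 (sub_smul_one_mulVec_eq_zero hM hc.le hy))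
  linarith [le_abs_self c]

/-- Convergence when the agents with maximal entry of the Perron vector are frozen at a common
extreme opinion `s = ±1`. -/
lemma solutionsTendTo_smul_div_norm (hN : 0 < N) (hM : M.IsSymm) (hP : EventuallyPositive M)
    {v : Fin N → ℝ} (hv : IsPosRightEigenvector M v) {s : ℝ} (hs : s ^ 2 = 1) {x₀ : Fin N → ℝ}
    (hx₀I : ∀ i, v i = ‖v‖ → x₀ i = s) (hx₀F : ∀ i, v i ≠ ‖v‖ → x₀ i ∈ Ioo (-1 : ℝ) 1) :
    SolutionsTendTo stubbornExtremists (M - specRad M • (1 : Matrix (Fin N) (Fin N) ℝ)) x₀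
      (s • ((1 / ‖v‖) • v)) := by
  have hv0 := hv.norm_pos hN
  have hp : ∀ i, v i = ‖v‖ → (s • ((1 / ‖v‖) • v)) i = s := fun i hi => by
    simp [hi, hv0.ne']
  refine solutionsTendTo_of_definite (I := Finset.univ.filter fun i => v i = ‖v‖)
    (isSymm_sub_smul_one hM _) (dotProduct_sub_smul_one_mulVec_nonpos hM le_rfl)
    (fun i hi => ?_) (fun i hi => ?_) (fun i hi => ?_) (fun y hyI hy => ?_) (fun i hi => ?_)
    (fun i hi => hx₀F i (by simpa using hi))
  · rw [hp i (by simpa using hi), hs]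
  · have hne : v i ≠ ‖v‖ := by simpa using hi
    have hlt : v i < ‖v‖ := lt_of_le_of_ne ((le_abs_self _).trans (norm_le_pi_norm v i)) hne
    have h1 : v i / ‖v‖ < 1 := (div_lt_one hv0).2 hlt
    have h2 : 0 < v i / ‖v‖ := div_pos (hv.1 i) hv0
    refine abs_lt.1 ((sq_lt_one_iff_abs_lt_one _).1 ?_)
    have h3 : (s • ((1 / ‖v‖) • v)) i = s * (v i / ‖v‖) := by
      simp only [Pi.smul_apply, smul_eq_mul]
      ring
    rw [h3, mul_pow, hs, one_mul]
    nlinarith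
  · rw [Matrix.mulVec_smul, Matrix.mulVec_smul, (sub_smul_one_mulVec_eq_zero_iff v).2 hv.2]
    simp
  -- A multiple of `v` that vanishes at a maximal entry of `v` is zero.
  · obtain ⟨a, rfl⟩ := hP.eq_smul_of_mulVec_eq hN hM hv
      ((sub_smul_one_mulVec_eq_zero_iff y).1 (sub_smul_one_mulVec_eq_zero hM le_rfl hy))
    obtain ⟨i, hi⟩ := hv.exists_eq_norm hN
    have h0 := hyI i (by simpa using hi)
    rw [Pi.smul_apply, smul_eq_mul, mul_eq_zero, or_iff_left (hv.1 i).ne'] at h0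
    rw [h0, zero_smul]
  · have hi' : v i = ‖v‖ := by simpa using hi
    rw [hp i hi', hx₀I i hi']

end DefiniteCase

/-! ### Block form of the reduced equilibrium -/

section ReducedEquilibrium

open scoped Matrix

variable {N : ℕ} {E : Matrix (Fin N) (Fin N) ℝ} {I : Finset (Fin N)}

lemma mulVec_apply_eq_blocks (E : Matrix (Fin N) (Fin N) ℝ) (I : Finset (Fin N)) (y : Fin N → ℝ)
    (i : {i // i ∉ I}) :
    (E *ᵥ y) i = (blockFreeFrozen E I *ᵥ fun j => y j) i + (blockFree E I *ᵥ fun j => y j) i := by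
  have h := (Fintype.sum_subtype_add_sum_subtype (fun j => j ∈ I) fun j => E i j * y j).symm
  simp only [Matrix.mulVec, dotProduct, blockFree, blockFreeFrozen, Matrix.submatrix_apply]
  convert h using 2
  exact Finset.sum_congr (by ext; simp) fun _ _ => rfl

lemma mulVec_reducedEquilibrium (hdet : IsUnit (blockFree E I).det) (y₁ : {i // i ∈ I} → ℝ)
    {i : Fin N} (hi : i ∉ I) : (E *ᵥ reducedEquilibrium E I y₁) i = 0 := by
  have h1 : (fun j : {i // i ∈ I} => reducedEquilibrium E I y₁ j) = y₁ := by
    ext j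
    simp [reducedEquilibrium, j.2]
  have h2 : (fun j : {i // i ∉ I} => reducedEquilibrium E I y₁ j) = freeEquilibrium E I y₁ := by
    ext j
    simp [reducedEquilibrium, j.2]
  rw [mulVec_apply_eq_blocks E I _ ⟨i, hi⟩, h1, h2, freeEquilibrium, Matrix.mulVec_mulVec,
    Matrix.mul_neg, Matrix.mul_nonsing_inv_cancel_left _ _ hdet, Matrix.neg_mulVec, Pi.neg_apply,
    add_neg_cancel]

/-- On vectors vanishing on `I`, the free rows of `E y = 0` read `E₂₂ y₂ = 0`. -/
lemma eq_zero_of_mulVec_eq_zero_of_frozen (hdet : IsUnit (blockFree E I).det) {y : Fin N → ℝ}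
    (hyI : ∀ i ∈ I, y i = 0) (hy : E *ᵥ y = 0) : y = 0 := by
  have h1 : (fun j : {i // i ∈ I} => y j) = 0 := funext fun j => hyI j j.2
  have h2 : (fun j : {i // i ∉ I} => y j) = 0 := by
    refine Matrix.eq_zero_of_mulVec_eq_zero hdet.ne_zero (funext fun i => ?_)
    have := mulVec_apply_eq_blocks E I y i
    rw [h1, hy, Matrix.mulVec_zero] at this
    simpa using this.symm
  ext i
  by_cases hi : i ∈ I
  · exact hyI i hi
  · exact congrFun h2 ⟨i, hi⟩

end ReducedEquilibrium

/-! ### Critical case in the open cube -/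

section CriticalInterior

open scoped Matrix

variable {N : ℕ} {E : Matrix (Fin N) (Fin N) ℝ} {v : Fin N → ℝ} {x : ℝ → Fin N → ℝ}

/-- A conserved quantity of the dynamics when `v` is a left null vector of the system matrix: twice
the `v`-weighted sum of the inverse hyperbolic tangents of the opinions. -/
noncomputable def weightedLogRatio (v q : Fin N → ℝ) : ℝ :=
  ∑ i, v i * (Real.log (1 + q i) - Real.log (1 - q i))

lemma continuousAt_weightedLogRatio (v : Fin N → ℝ) {q : Fin N → ℝ}
    (hq : ∀ i, q i ∈ Ioo (-1 : ℝ) 1) : ContinuousAt (weightedLogRatio v) q := by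
  refine tendsto_finsetSum _ fun i _ => ?_
  have hi : ContinuousAt (fun q : Fin N → ℝ => q i) q := (continuous_apply i).continuousAt
  have h1 : 1 + q i ≠ 0 := by linarith [(hq i).1]
  have h2 : 1 - q i ≠ 0 := by linarith [(hq i).2]
  exact continuousAt_const.mul
    (((continuousAt_const.add hi).log h1).sub ((continuousAt_const.sub hi).log h2))

lemma weightedLogRatio_smul_lt (hN : 0 < N) (hv : ∀ i, 0 < v i) {a b : ℝ}
    (ha : ∀ i, (a • v) i ∈ Ioo (-1 : ℝ) 1) (hb : ∀ i, (b • v) i ∈ Ioo (-1 : ℝ) 1) (hab : a < b) :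
    weightedLogRatio v (a • v) < weightedLogRatio v (b • v) := by
  have : Nonempty (Fin N) := ⟨⟨0, hN⟩⟩
  refine Finset.sum_lt_sum_of_nonempty Finset.univ_nonempty fun i _ => ?_
  have hlt : (a • v) i < (b • v) i := mul_lt_mul_of_pos_right hab (hv i)
  have h1 : Real.log (1 + (a • v) i) < Real.log (1 + (b • v) i) :=
    Real.log_lt_log (by linarith [(ha i).1]) (by linarith)
  have h2 : Real.log (1 - (b • v) i) < Real.log (1 - (a • v) i) :=
    Real.log_lt_log (by linarith [(hb i).2]) (by linarith)
  exact mul_lt_mul_of_pos_left (by linarith) (hv i)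

lemma eq_of_weightedLogRatio_smul_eq (hN : 0 < N) (hv : ∀ i, 0 < v i) {a b : ℝ}
    (ha : ∀ i, (a • v) i ∈ Ioo (-1 : ℝ) 1) (hb : ∀ i, (b • v) i ∈ Ioo (-1 : ℝ) 1)
    (h : weightedLogRatio v (a • v) = weightedLogRatio v (b • v)) : a = b := by
  rcases lt_trichotomy a b with hlt | heq | hgt
  · exact absurd h (weightedLogRatio_smul_lt hN hv ha hb hlt).ne
  · exact heq
  · exact absurd h (weightedLogRatio_smul_lt hN hv hb ha hgt).ne'

lemma isFrozenState_empty {x₀ : Fin N → ℝ} (h : ∀ i, x₀ i ∈ Ioo (-1 : ℝ) 1) :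
    IsFrozenState ∅ x₀ :=
  ⟨by simp, fun i _ => h i⟩

namespace IsSolution

lemma mem_Ioo (hx : IsSolution stubbornExtremists E x) (h₀ : ∀ i, x 0 i ∈ Ioo (-1 : ℝ) 1) {t : ℝ}
    (ht : 0 ≤ t) (i : Fin N) : x t i ∈ Ioo (-1 : ℝ) 1 :=
  (hx.frozen_or_mem_Ioo (isFrozenState_empty h₀) ht).2 i (Finset.notMem_empty i)

/-- The derivative is `2 vᵀ E x = 2 (E v)ᵀ x = 0`. -/
lemma weightedLogRatio_eq (hE : E.IsSymm) (hv : E *ᵥ v = 0)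
    (hx : IsSolution stubbornExtremists E x) (h₀ : ∀ i, x 0 i ∈ Ioo (-1 : ℝ) 1) {t : ℝ}
    (ht : 0 ≤ t) : weightedLogRatio v (x t) = weightedLogRatio v (x 0) := by
  refine eq_of_hasDerivWithinAt_zero (f := fun t => weightedLogRatio v (x t)) (fun t ht => ?_) ht
  have h : ∀ i ∈ Finset.univ, HasDerivWithinAt
      (fun s => v i * (Real.log (1 + x s i) - Real.log (1 - x s i)))
      (2 * (v i * (E *ᵥ x t) i)) (Ici 0) t := fun i _ => by
    obtain ⟨h1, h2⟩ := hx.mem_Ioo h₀ ht i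
    have h3 : 1 + x t i ≠ 0 := by linarith
    have h4 : 1 - x t i ≠ 0 := by linarith
    have hd := hx.hasDerivWithinAt_apply ht i
    refine ((((hd.const_add 1).log h3).sub ((hd.const_sub 1).log h4)).const_mul
      (v i)).congr_deriv ?_
    field_simp
    ring
  refine (HasDerivWithinAt.fun_sum h).congr_deriv ?_
  rw [← Finset.mul_sum]
  have : v ⬝ᵥ E *ᵥ x t = 0 := by rw [dotProduct_mulVec_comm hE, hv, zero_dotProduct]
  rw [dotProduct] at this
  rw [this, mul_zero]

/-- A trajectory starting in the open cube stays away from the boundary. -/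
lemma exists_pos_le_one_sub_sq (hneg : ∀ y, y ⬝ᵥ E *ᵥ y ≤ 0)
    (hx : IsSolution stubbornExtremists E x) (h₀ : ∀ i, x 0 i ∈ Ioo (-1 : ℝ) 1) :
    ∃ δ > 0, ∀ t, 0 ≤ t → ∀ i, δ ≤ 1 - x t i ^ 2 := by
  set W : ℝ → ℝ := fun t => ∑ i ∈ (∅ : Finset (Fin N))ᶜ, barrier ((0 : Fin N → ℝ) i) (x t i) with hW
  have hanti : AntitoneOn W (Ici 0) := antitoneOn_Ici_of_hasDerivWithinAt
    (fun t ht => hx.hasDerivWithinAt_sum_barrier (p := 0) (isFrozenState_empty h₀) (by simp)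
      (by simp) ht) (fun t _ => hneg _)
  -- Each barrier is `log 2 - log (1 - s²) / 2 ≤ W 0`, so `log (1 - s²) ≥ -2 W 0`.
  refine ⟨Real.exp (-(2 * W 0)), Real.exp_pos _, fun t ht i => ?_⟩
  have hle : barrier 0 (x t i) ≤ W 0 := by
    refine le_trans ?_ (hanti (mem_Ici.2 le_rfl) ht ht)
    exact Finset.single_le_sum (f := fun i => barrier ((0 : Fin N → ℝ) i) (x t i))
      (fun j _ => barrier_nonneg (by simp) (hx.mem_Ioo h₀ ht j)) (by simp)
  obtain ⟨h1, h2⟩ := hx.mem_Ioo h₀ ht i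
  have h3 : 0 < 1 - x t i := by linarith
  have h4 : 0 < 1 + x t i := by linarith
  have hlog : Real.log (1 - x t i ^ 2) = Real.log (1 - x t i) + Real.log (1 + x t i) := by
    rw [← Real.log_mul h3.ne' h4.ne']
    congr 1
    ring
  rw [← Real.le_log_iff_exp_le (by nlinarith), hlog]
  have := Real.log_pos one_lt_two
  rw [barrier] at hle
  linarith

end IsSolution

lemma EventuallyPositive.exists_solutionsTendTo_smul {M : Matrix (Fin N) (Fin N) ℝ} (hN : 0 < N)
    (hM : M.IsSymm) (hP : EventuallyPositive M) (hv : IsPosRightEigenvector M v) {x₀ : Fin N → ℝ}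
    (h₀ : ∀ i, x₀ i ∈ Ioo (-1 : ℝ) 1) :
    ∃ α : ℝ, (∀ i, (α • v) i ∈ Ioo (-1 : ℝ) 1) ∧
      SolutionsTendTo stubbornExtremists (M - specRad M • (1 : Matrix (Fin N) (Fin N) ℝ)) x₀
        (α • v) := by
  set E := M - specRad M • (1 : Matrix (Fin N) (Fin N) ℝ) with hEdef
  have hE : E.IsSymm := isSymm_sub_smul_one hM _
  have hneg : ∀ y, y ⬝ᵥ E *ᵥ y ≤ 0 := dotProduct_sub_smul_one_mulVec_nonpos hM le_rfl
  have hEv : E *ᵥ v = 0 := (sub_smul_one_mulVec_eq_zero_iff v).2 hv.2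
  have hcompact : ∀ x, IsSolution stubbornExtremists E x → x 0 = x₀ →
      ∃ S : Set (Fin N → ℝ), IsCompact S ∧ (∀ᶠ t in atTop, x t ∈ S) ∧
        ∀ q ∈ S, MapClusterPt q atTop x → (∀ i, q i ∈ Ioo (-1 : ℝ) 1) ∧
          weightedLogRatio v q = weightedLogRatio v x₀ ∧ ∃ a : ℝ, q = a • v := by
    intro x hx hx0
    subst hx0
    obtain ⟨δ, hδ, hle⟩ := hx.exists_pos_le_one_sub_sq hneg h₀
    refine ⟨Icc (-1) 1 ∩ {q | ∀ i, δ ≤ 1 - q i ^ 2}, isCompact_Icc.inter_right ?_, ?_, ?_⟩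
    · simp only [ofPred_forall]
      exact isClosed_iInter fun i => isClosed_le continuous_const (by fun_prop)
    · filter_upwards [eventually_ge_atTop 0] with t ht
      exact ⟨hx.mem_Icc (isFrozenState_empty h₀) ht, hle t ht⟩
    · rintro q ⟨-, hq⟩ hcl
      have hqI : ∀ i, q i ∈ Ioo (-1 : ℝ) 1 := fun i =>
        abs_lt.1 ((sq_lt_one_iff_abs_lt_one _).1 (by linarith [hq i]))
      refine ⟨hqI, ?_, ?_⟩
      · refine hcl.eq_of_tendsto_comp (continuousAt_weightedLogRatio v hqI)
          (tendsto_const_nhds.congr' ?_)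
        filter_upwards [eventually_ge_atTop 0] with t ht
        exact (hx.weightedLogRatio_eq hE hEv h₀ ht).symm
      · have h := (hx.quadratic_form_eq_zero_of_mapClusterPt (p := 0) hE hneg
          (isFrozenState_empty h₀) (by simp) (by simp) (by simp) hcl).2
        rw [sub_zero] at h
        exact hP.eq_smul_of_mulVec_eq hN hM hv
          ((sub_smul_one_mulVec_eq_zero_iff q).1 (sub_smul_one_mulVec_eq_zero hM le_rfl h))
  -- A cluster point of one solution supplies `α`; any other solution from `x₀` has the same
  -- conserved value, hence the same sole cluster point.
  obtain ⟨x, hx, hx0⟩ := exists_isSolution E (isFrozenState_empty h₀)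
  obtain ⟨S, hS, hmem, hcl⟩ := hcompact x hx hx0
  obtain ⟨q, hqS, hq⟩ := hS.exists_mapClusterPt (f := atTop) (u := x)
    (le_principal_iff.2 hmem)
  obtain ⟨hqI, hqK, α, rfl⟩ := hcl q hqS hq
  refine ⟨α, hqI, ⟨x, hx, hx0⟩, fun z hz hz0 => ?_⟩
  obtain ⟨T, hT, hmemT, hclT⟩ := hcompact z hz hz0
  refine hT.tendsto_nhds_of_unique_mapClusterPt hmemT fun r hrT hr => ?_
  obtain ⟨hrI, hrK, β, rfl⟩ := hclT r hrT hr
  rw [eq_of_weightedLogRatio_smul_eq hN hv.1 hrI hqI (hrK.trans hqK.symm)]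

end CriticalInterior

/-! ### Assembly of the statements -/

section Main

variable {N : ℕ}

/-- Common form of the two assumptions: `c` is the shared forgetting factor with `M = B`, or `c = d`
with `M = C`. -/
theorem EventuallyPositive.stubbornExtremistsConvergence {M : Matrix (Fin N) (Fin N) ℝ} {c : ℝ}
    (hN : 0 < N) (hM : M.IsSymm) (hP : EventuallyPositive M) (hc : specRad M ≤ c) :
    StubbornExtremistsConvergence M (M - c • (1 : Matrix (Fin N) (Fin N) ℝ)) (c = specRad M) := by
  refine ⟨hP.exists_isPosRightEigenvector hN hM, fun v hv x₀ hx₀ => ?_, ?_, ?_, ?_⟩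
  · have hv0 := hv.norm_pos hN
    rcases hc.lt_or_eq with hlt | rfl
    · refine ⟨0, by simp [hv0], ?_⟩
      rw [zero_smul]
      exact solutionsTendTo_zero hM hlt hx₀
    · obtain ⟨α, hα, h⟩ := hP.exists_solutionsTendTo_smul hN hM hv hx₀
      refine ⟨α, ?_, h⟩
      obtain ⟨i, hi⟩ := hv.exists_eq_norm hN
      have := hα i
      rw [Pi.smul_apply, hi, smul_eq_mul] at this
      rw [← neg_div]
      exact ⟨(div_lt_iff₀ hv0).2 this.1, (lt_div_iff₀ hv0).2 this.2⟩
  · intro I _ _ y₁ hy₁ hdet hfree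
    set p := reducedEquilibrium (M - c • (1 : Matrix (Fin N) (Fin N) ℝ)) I y₁ with hp
    have hpI : ∀ i (hi : i ∈ I), p i = y₁ ⟨i, hi⟩ := fun i hi => by
      simp [hp, reducedEquilibrium, hi]
    have hpF : ∀ i ∉ I, p i ∈ Ioo (-1 : ℝ) 1 := fun i hi => by
      simpa only [hp, reducedEquilibrium, hi, dite_false] using hfree ⟨i, hi⟩
    have hsq : ∀ i ∈ I, p i ^ 2 = 1 := fun i hi => by rw [hpI i hi, ← sq_abs, hy₁, one_pow]
    have hEp : ∀ i ∉ I, ((M - c • (1 : Matrix (Fin N) (Fin N) ℝ)).mulVec p) i = 0 :=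
      fun i hi => mulVec_reducedEquilibrium hdet y₁ hi
    refine ⟨funext fun i => ?_, fun x₀ hx₀I hx₀F => ?_⟩
    · rw [opinionField_apply]
      by_cases hi : i ∈ I
      · rw [stubbornExtremists, hsq i hi, sub_self, zero_mul, Pi.zero_apply]
      · rw [hEp i hi, mul_zero, Pi.zero_apply]
    · exact solutionsTendTo_of_definite (isSymm_sub_smul_one hM c)
        (dotProduct_sub_smul_one_mulVec_nonpos hM hc) hsq hpF hEp
        (fun y hyI hy => eq_zero_of_mulVec_eq_zero_of_frozen hdet hyI
          (sub_smul_one_mulVec_eq_zero hM hc hy))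
        (fun i hi => (hx₀I ⟨i, hi⟩).trans (hpI i hi).symm) hx₀F
  · rintro rfl v hv - x₀ hx₀I hx₀F
    simpa using solutionsTendTo_smul_div_norm hN hM hP hv (one_pow 2) hx₀I hx₀F
  · rintro rfl v hv - x₀ hx₀I hx₀F
    simpa using solutionsTendTo_smul_div_norm hN hM hP hv (s := -1) (by norm_num) hx₀I hx₀F

end Main

theorem corollary3 {N : ℕ} (hN : 0 < N) (B : Matrix (Fin N) (Fin N) ℝ) (σ : Fin N → ℝ)
    (hdiag : ∀ i, B i i = 0) (hσ : ∀ i, 0 < σ i) (hconn : StronglyConnected B)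
    (hundirected : B.IsSymm) :
    (Assumption1 B σ →
      StubbornExtremistsConvergence B (systemMatrix B σ) (∀ i, σ i = specRad B)) ∧
    (∀ d : ℝ, Assumption2 B σ d →
      StubbornExtremistsConvergence (shiftedMatrix B σ d) (systemMatrix B σ)
        (d = specRad (shiftedMatrix B σ d))) := by
  refine ⟨fun ⟨hP, hconst, hle⟩ => ?_, fun d ⟨_, hP, hle⟩ => ?_⟩
  · let i₀ : Fin N := ⟨0, hN⟩
    have hE : systemMatrix B σ = B - σ i₀ • (1 : Matrix (Fin N) (Fin N) ℝ) := by
      rw [systemMatrix, Matrix.smul_one_eq_diagonal]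
      congr 2
      exact funext fun i => hconst i i₀
    have hcrit : (∀ i, σ i = specRad B) = (σ i₀ = specRad B) :=
      propext ⟨fun h => h i₀, fun h i => (hconst i i₀).trans h⟩
    rw [hE, hcrit]
    exact hP.stubbornExtremistsConvergence hN hundirected (hle i₀)
  · have hE : systemMatrix B σ =
        shiftedMatrix B σ d - d • (1 : Matrix (Fin N) (Fin N) ℝ) := by
      rw [systemMatrix, shiftedMatrix]
      abel
    have hsymm : (shiftedMatrix B σ d).IsSymm := by
      rw [Matrix.IsSymm, shiftedMatrix, Matrix.transpose_add, Matrix.transpose_sub,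
        Matrix.transpose_smul, Matrix.transpose_one, Matrix.diagonal_transpose, hundirected.eq]
    rw [hE]
    exact hP.stubbornExtremistsConvergence hN hsymm hle
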